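/- **Setting.** Let $\mathcal S_0$ be a set of prompts and $\mathcal S_1,\mathcal S_2,\dots$ sets of reasoning steps; prefixes are $s_{1:t}\in\mathcal S_{1:t}=\mathcal S_1\times\dots\times\mathcal S_t$, with $\mathcal S_{1:0}=\{\varnothing\}$. A base model gives, for every prompt $s_0$ and every prefix, a discrete probability law $\pi_{\rm ref}(\cdot\mid s_0,s_{1:t})$ on $\mathcal S_{t+1}$, and $\pi_{\rm ref}(s_{1:T}\mid s_0)=\prod_{t=1}^T\pi_{\rm ref}(s_t\mid s_0,s_{1:t-1})$. A reward model assigns a real number $\hat V(s_0,s_{1:t})>0$ to every prefix (including $\varnothing$, where one may normalize $\hat V(s_0,\varnothing)=1$). For a horizon $T\ge1$ the target is $\tilde\pi_T(s_{1:T}\mid s_0)\propto\pi_{\rm ref}(s_{1:T}\mid s_0)\,\hat V(s_0,s_{1:T})$. **Assumptions** (for a prompt $s_0$, horizon $T$ and constants $L,\varepsilon>0$). 1. (Ratio bound) $\max\Big\{\frac{\hat V(s_0,s_{1:t-1})}{\hat V(s_0,s_{1:t})},\frac{\hat V(s_0,s_{1:t})}{\hat V(s_0,s_{1:t-1})}\Big\}\le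 L$ for all $1\le t\le T$ and all $s_{1:t}\in\mathcal S_{1:t}$. 2. (Bellman error bound) $\max\Big\{\frac{\hat V(s_0,s_{1:t})}{\mathbb E[\hat V(s_0,s_{1:t+1})]},\frac{\mathbb E[\hat V(s_0,s_{1:t+1})]}{\hat V(s_0,s_{1:t})}\Big\}\le1+\varepsilon$ for all $1\le t\le T-1$ and all $s_{1:t}\in\mathcal S_{1:t}$, where the (finite) expectation is over $s_{t+1}\sim\pi_{\rm ref}(\cdot\mid s_0,s_{1:t})$. **Algorithm** (naive-proposal SMC with $N$ particles). Draw $S_1^1,\dots,S_1^N$ i.i.d. from $\pi_{\rm ref}(\cdot\mid s_0)$. For $t=2,\dots,T$: compute the weights $w^j=\hat V(s_0,S^j_{1:t-1})/\hat V(s_0,S^j_{1:t-2})$ and normalize them, draw $A^1,\dots,A^N$ i.i.d. from the resulting categorical law, draw $S_t^i\sim\pi_{\rm ref}(\cdot\mid s_0,S_{1:t-1}^{A^i})$ independently for all $i$, and set $S^i_{1:t}=(S_{1:t-1}^{A^i},S_t^i)$. Finally resample once more in the same way with the weights $\hat V(s_0,S^j_{1:T})/\hat V(s_0,S^j_{1:T-1})$,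 without propagation, and output one of the $N$ resampled particles, chosen uniformly at random. Let $\hat\pi_T$ be the law of the output. Running time is the worst-case number of elementary operations over all random outcomes: a draw from the base model at a prefix, an evaluation of $\hat V$ at a prefix, an addition or division of real numbers, a bookkeeping step and a draw of a uniform index cost one unit each; $m$ independent draws from a categorical law given by $N$ weights cost $N+m$ units. **Claim.** For every $c>0$ there is a constant $C>0$, depending only on $c$, such that for all $T\ge1$, $L>0$ and $\delta_{\rm TV}\in(0,1)$ there is a number of particles $N\ge1$, depending only on $c,T,L,\delta_{\rm TV}$, with the following property. For all step spaces, base models, reward models and prompts that satisfy the two assumptions with constants $L$ and some $\varepsilon\in(0,c/T]$, naive-proposal SMC with $N$ particles satisfies $$\|\tilde\pi_T(\cdot\mid s_0)-\hat\pi_T\|_{\rm TV}\le\delta_{\rm TV},$$ and its running time is at most $C\,L^6T^2/\delta_{\rm TV}$. -/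

import Mathlib

open scoped ENNReal

universe u v w

namespace InferenceSMC

/-! ### Prefixes, base model and reward model -/

/-- The prefix spaces `S_{1:0} = {∅}` and `S_{1:t+1} = S_{1:t} × S_{t+1}`. -/
def Prefix (S : ℕ → Type u) : ℕ → Type u
  | 0 => PUnit
  | t + 1 => Prefix S t × S (t + 1)

/-- The prefix `s_{1:t}` of `s_{1:t+1}`. -/
def Prefix.init {S : ℕ → Type u} {t : ℕ} (x : Prefix S (t + 1)) : Prefix S t := Prod.fst x

/-- The prefix `s_{1:t+1} = (s_{1:t}, s_{t+1})`. -/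
def Prefix.snoc {S : ℕ → Type u} {t : ℕ} (x : Prefix S t) (s : S (t + 1)) : Prefix S (t + 1) :=
  Prod.mk x s

/-- An autoregressive base model and a (strictly positive) reward model on prefixes.
`S 0` is the prompt space and `S t` the space of the `t`-th reasoning step.
The terminal reward `φ` is `V s₀` on prefixes of length the horizon. -/
structure Model (S : ℕ → Type u) where
  /-- `ref s₀ x` is the law `π_ref(· | s₀, x)` of the step that follows the prefix `x`. -/
  ref : S 0 → {t : ℕ} → Prefix S t → PMF (S (t + 1))
  /-- `V s₀ x` is the reward of the prefix `x`. -/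
  V : S 0 → {t : ℕ} → Prefix S t → ℝ
  V_pos : ∀ (s₀ : S 0) {t : ℕ} (x : Prefix S t), 0 < V s₀ x

namespace Model

variable {S : ℕ → Type u}

/-- The law `π_ref(s_{1:t} | s₀) = ∏_{r ≤ t} π_ref(s_r | s₀, s_{1:r-1})`. -/
noncomputable def refLaw (M : Model S) (s₀ : S 0) : (t : ℕ) → PMF (Prefix S t)
  | 0 => PMF.pure PUnit.unit
  | t + 1 => (M.refLaw s₀ t).bind fun x => (M.ref s₀ x).map fun s => x.snoc s

/-- Reward model ratio bound with constant `L` up to the horizon `T`. -/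
def RatioBound (M : Model S) (s₀ : S 0) (T : ℕ) (L : ℝ) : Prop :=
  ∀ t : ℕ, t + 1 ≤ T → ∀ x : Prefix S (t + 1),
    max (M.V s₀ x.init / M.V s₀ x) (M.V s₀ x / M.V s₀ x.init) ≤ L

/-- The one-step look-ahead `E_{s ∼ π_ref(· | s₀, x)} V(s₀, (x, s))`. -/
noncomputable def lookahead (M : Model S) (s₀ : S 0) {t : ℕ} (x : Prefix S t) : ℝ :=
  ∑' s : S (t + 1), (M.ref s₀ x s).toReal * M.V s₀ (x.snoc s)

/-- Uniform bound `1 + ε` on the one-step Bellman ratios, up to the horizon `T`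
(the look-ahead of a prefix of length `t` exists within the horizon for `t < T`).
The expectations are required to be finite. -/
def BellmanBound (M : Model S) (s₀ : S 0) (T : ℕ) (ε : ℝ) : Prop :=
  ∀ t : ℕ, 1 ≤ t → t < T → ∀ x : Prefix S t,
    (Summable fun s : S (t + 1) => (M.ref s₀ x s).toReal * M.V s₀ (x.snoc s)) ∧
    max (M.V s₀ x / M.lookahead s₀ x) (M.lookahead s₀ x / M.V s₀ x) ≤ 1 + ε

theorem RatioBound.V_le {M : Model S} {s₀ : S 0} {T : ℕ} {L : ℝ} (h : M.RatioBound s₀ T L) :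
    ∀ t : ℕ, t ≤ T → ∀ x : Prefix S t, M.V s₀ x ≤ |L| ^ t * M.V s₀ (t := 0) PUnit.unit
  | 0, _, x => by
    have hx : x = (PUnit.unit : Prefix S 0) := rfl
    rw [hx]; simp
  | t + 1, ht, x => by
    have ih := RatioBound.V_le h t (by omega) x.init
    have h1 : M.V s₀ x / M.V s₀ x.init ≤ |L| :=
      ((le_max_right _ _).trans (h t ht x)).trans (le_abs_self L)
    have h2 := (div_le_iff₀ (M.V_pos s₀ x.init)).1 h1
    calc M.V s₀ x ≤ |L| * M.V s₀ x.init := h2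
      _ ≤ |L| * (|L| ^ t * M.V s₀ (t := 0) PUnit.unit) :=
        mul_le_mul_of_nonneg_left ih (abs_nonneg L)
      _ = _ := by ring

theorem normalizer_ne_zero (M : Model S) (s₀ : S 0) (T : ℕ) :
    ∑' x, M.refLaw s₀ T x * ENNReal.ofReal (M.V s₀ x) ≠ 0 := by
  intro h0
  rw [ENNReal.tsum_eq_zero] at h0
  obtain ⟨x, hx⟩ := (M.refLaw s₀ T).support_nonempty
  rcases mul_eq_zero.1 (h0 x) with h | h
  · exact (PMF.mem_support_iff _ _).1 hx h
  · exact absurd (ENNReal.ofReal_eq_zero.1 h) (not_le.2 (M.V_pos s₀ x))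

theorem RatioBound.normalizer_ne_top {M : Model S} {s₀ : S 0} {T : ℕ} {L : ℝ}
    (h : M.RatioBound s₀ T L) :
    ∑' x, M.refLaw s₀ T x * ENNReal.ofReal (M.V s₀ x) ≠ ⊤ := by
  refine ne_top_of_le_ne_top
    (ENNReal.ofReal_ne_top (r := |L| ^ T * M.V s₀ (t := 0) PUnit.unit)) ?_
  calc ∑' x, M.refLaw s₀ T x * ENNReal.ofReal (M.V s₀ x)
      ≤ ∑' x, M.refLaw s₀ T x * ENNReal.ofReal (|L| ^ T * M.V s₀ (t := 0) PUnit.unit) :=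
        ENNReal.tsum_le_tsum fun x =>
          mul_le_mul_right (ENNReal.ofReal_le_ofReal (h.V_le T le_rfl x)) _
    _ = _ := by rw [ENNReal.tsum_mul_right, PMF.tsum_coe, one_mul]

/-- The target `π̃_T(s_{1:T} | s₀) ∝ π_ref(s_{1:T} | s₀) V(s₀, s_{1:T})`.
The ratio bound only serves to show that the normalizing constant is finite. -/
noncomputable def target (M : Model S) (s₀ : S 0) (T : ℕ) {L : ℝ}
    (h : M.RatioBound s₀ T L) : PMF (Prefix S T) :=
  PMF.normalize (fun x => M.refLaw s₀ T x * ENNReal.ofReal (M.V s₀ x))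
    (M.normalizer_ne_zero s₀ T) h.normalizer_ne_top

end Model

/-- Total variation distance of two discrete laws. -/
noncomputable def tvDist {α : Type v} (p q : PMF α) : ℝ :=
  (1 / 2) * ∑' a, |(p a).toReal - (q a).toReal|

/-! ### Discrete sampling primitives -/

/-- The categorical law `Cat(w / ∑ w)` of a weight vector
(uniform if the weights are not nonnegative with positive sum). -/
noncomputable def categorical {N : ℕ+} (w : Fin N → ℝ) : PMF (Fin N) :=
  open Classical in
  if h : (∀ i, 0 ≤ w i) ∧ ∃ i, 0 < w i then
    PMF.normalize (fun i => ENNReal.ofReal (w i))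
      (by
        obtain ⟨i, hi⟩ := h.2
        intro h0
        exact absurd (ENNReal.ofReal_eq_zero.1 (ENNReal.tsum_eq_zero.1 h0 i)) (not_le.2 hi))
      (by
        rw [tsum_fintype]
        exact ENNReal.sum_ne_top.2 fun i _ => ENNReal.ofReal_ne_top)
  else
    PMF.uniformOfFintype (Fin N)

/-- The joint law of `m` independent draws from `p`. -/
noncomputable def iid {α : Type v} (p : PMF α) : (m : ℕ) → PMF (Fin m → α)
  | 0 => PMF.pure Fin.elim0
  | m + 1 => p.bind fun a => (iid p m).map fun z => Fin.cons a z

/-! ### Randomized programs with black-box access to the base and the reward model -/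

/-- Randomized programs with result in `α`. The base model can only be sampled from, the reward
model can only be evaluated, both at prefixes that the program names; the further instructions are
additions and divisions of real numbers, bookkeeping steps, and draws of random indices. -/
inductive Prog (S : ℕ → Type u) (α : Type v) : Type (max u v)
  /-- halt with result `a` -/
  | done (a : α)
  /-- one bookkeeping step (storing one entry) -/
  | tick (k : Prog S α)
  /-- compute `a + b` -/
  | add (a b : ℝ) (k : ℝ → Prog S α)
  /-- compute `a / b` -/
  | div (a b : ℝ) (k : ℝ → Prog S α)
  /-- draw a step from the base model after the prefix `x` -/
  | sample {t : ℕ} (x : Prefix S t) (k : S (t + 1) → Prog S α)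
  /-- evaluate the reward model at the prefix `x` -/
  | reward {t : ℕ} (x : Prefix S t) (k : ℝ → Prog S α)
  /-- draw `m` independent indices from the categorical law with weights `w` -/
  | draw {N : ℕ+} (w : Fin N → ℝ) (m : ℕ) (k : (Fin m → Fin N) → Prog S α)
  /-- draw a uniform index -/
  | uniform (N : ℕ+) (k : Fin N → Prog S α)

namespace Prog

variable {S : ℕ → Type u} {α : Type v} {β : Type w}

/-- Sequential composition. -/
def bind : Prog S α → (α → Prog S β) → Prog S β
  | done a, f => f a
  | tick k, f => tick (k.bind f)
  | add a b k, f => add a b fun r => (k r).bind f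
  | div a b k, f => div a b fun r => (k r).bind f
  | sample x k, f => sample x fun s => (k s).bind f
  | reward x k, f => reward x fun r => (k r).bind f
  | draw w m k, f => draw w m fun z => (k z).bind f
  | uniform N k, f => uniform N fun i => (k i).bind f

/-- The law of the result of a program, run on the model `M` and the prompt `s₀`. -/
noncomputable def law (M : Model S) (s₀ : S 0) : Prog S α → PMF α
  | done a => PMF.pure a
  | tick k => k.law M s₀
  | add a b k => (k (a + b)).law M s₀
  | div a b k => (k (a / b)).law M s₀
  | sample x k => (M.ref s₀ x).bind fun s => (k s).law M s₀
  | reward x k => (k (M.V s₀ x)).law M s₀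
  | draw w m k => (iid (categorical w) m).bind fun z => (k z).law M s₀
  | uniform N k => (PMF.uniformOfFintype (Fin N)).bind fun i => (k i).law M s₀

/-- The worst-case running time of a program over all random outcomes. Each instruction takes one
unit of time, except that `m` draws from a vector of `N` weights take `N + m` units: `N` to
tabulate the weights (as in the alias method) and one for each draw. -/
noncomputable def time (M : Model S) (s₀ : S 0) : Prog S α → ℕ∞
  | done _ => 0
  | tick k => 1 + k.time M s₀
  | add a b k => 1 + (k (a + b)).time M s₀
  | div a b k => 1 + (k (a / b)).time M s₀
  | sample _ k => 1 + ⨆ s, (k s).time M s₀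
  | reward x k => 1 + (k (M.V s₀ x)).time M s₀
  | draw (N := N) _ m k => (((N : ℕ) + m : ℕ) : ℕ∞) + ⨆ z, (k z).time M s₀
  | uniform _ k => 1 + ⨆ i, (k i).time M s₀

/-- Run the programs `f 0, …, f (n - 1)` one after the other and store their results. -/
def forEach : (n : ℕ) → (Fin n → Prog S α) → Prog S (Fin n → α)
  | 0, _ => done Fin.elim0
  | n + 1, f => (f 0).bind fun a => tick
      ((forEach n fun i => f i.succ).bind fun z => done (Fin.cons a z))

/-- Add up the entries of a vector. -/
noncomputable def total : (n : ℕ) → (Fin n → ℝ) → Prog S ℝ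
  | 0, _ => done 0
  | n + 1, a => (total n fun i => a i.succ).bind fun r => add (a 0) r done

end Prog

/-! ### Sequential Monte Carlo with the naive proposal -/

section SMC

open Prog

variable {S : ℕ → Type u}

/-- Weighting and resampling: from particles `X^1, …, X^N` compute the incremental weights
`w^j = V(X^j) / V(X^j without its last step)`, normalize them, and draw `N` independent ancestor
indices from the resulting categorical law. -/
noncomputable def ancestors (N : ℕ+) {t : ℕ} (X : Fin N → Prefix S (t + 1)) :
    Prog S (Fin N → Fin N) :=
  (forEach N fun j => reward (X j) fun a => reward (X j).init fun b => div a b done).bind fun w =>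
  (total N w).bind fun Z =>
  (forEach N fun j => div (w j) Z done).bind fun wbar =>
  draw wbar N done

/-- Propagation with the naive proposal: extend each prefix by a draw from the base model. -/
def propagate (N : ℕ+) {t : ℕ} (X : Fin N → Prefix S t) : Prog S (Fin N → Prefix S (t + 1)) :=
  forEach N fun i => sample (X i) fun s => done ((X i).snoc s)

/-- `particles N t` produces the `N` particles at time `t + 1`. -/
noncomputable def particles (N : ℕ+) : (t : ℕ) → Prog S (Fin N → Prefix S (t + 1))
  | 0 => propagate N (t := 0) fun _ => PUnit.unit
  | t + 1 => (particles N t).bind fun X => (ancestors N X).bind fun A =>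
      propagate N fun i => X (A i)

/-- Naive-proposal SMC with `N` particles and horizon `T`: after time `T` there is a last
resampling (with identity propagation), and a uniformly chosen particle is returned. -/
noncomputable def naiveSMC (N : ℕ+) : (T : ℕ) → Prog S (Prefix S T)
  | 0 => done PUnit.unit
  | T + 1 => (particles N T).bind fun X => (ancestors N X).bind fun A =>
      (forEach N fun i => done (X (A i))).bind fun Y => uniform N fun i => done (Y i)

end SMC

end InferenceSMC

/-! The target `p` is dominated pointwise by the output law `q`: `p ≤ (1 + (K L)² / N)^T q` with `K
= exp c` (`target_le`). This alone gives total variation at most `T (K L)² / N`, so `N` of order `T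
L² / δ` suffices, and the running time is of order `N T`.

For fixed `y`, `q y` is the mean of a quotient `∑ f / ∑ h` of particle sums. Quotients do not
average well, but `a / b` is the supremum over `l` of `2 l a - l² a b`, and lower bounds of that
quadratic shape survive averaging. Over independent particles `E[∑ f ∑ h] ≤ N² (1 + ρ / N) E f E h`
whenever `E[f h] ≤ ρ E f E h`, so only the quadratic coefficient grows, by the factor `1 + ρ / N`
(`expect_iid_lower_bound`).

Given the current particles, the next ones are independent draws from `transition`. The means of the
new `f`, `h` are particle sums for the conditional expectations of `F`, `H`, over a common
normalizer that is absorbed in `l` (`expect_transition_ratio`). The bound thus travels from the last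
step back to the first (`particles_lower_bound`), where `F`, `H` are averaged under the base model.
At each time `H` is the conditional mean of the final reward. The Bellman errors keep it within `(1
+ ε)^(T-1) ≤ exp c` of the current reward, and with the ratio bound this gives `ρ ≤ (K L)²`. -/

namespace InferenceSMC

/-! ### Expectations and independent draws -/

section Expect

variable {α : Type v} {β : Type w}

/-- The expectation of a nonnegative function under a discrete law. -/
noncomputable def expect (p : PMF α) (f : α → ℝ≥0∞) : ℝ≥0∞ := ∑' a, p a * f a

theorem expect_pure (a : α) (f : α → ℝ≥0∞) : expect (PMF.pure a) f = f a := by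
  rw [expect, tsum_eq_single a]
  · simp
  · intro b hb
    simp [PMF.pure_apply, hb]

theorem expect_bind (p : PMF α) (k : α → PMF β) (f : β → ℝ≥0∞) :
    expect (p.bind k) f = expect p fun a => expect (k a) f := by
  simp only [expect, PMF.bind_apply, ← ENNReal.tsum_mul_right, ← ENNReal.tsum_mul_left]
  rw [ENNReal.tsum_comm]
  simp only [mul_assoc]

theorem expect_map (p : PMF α) (k : α → β) (f : β → ℝ≥0∞) :
    expect (p.map k) f = expect p fun a => f (k a) := by
  rw [← PMF.bind_pure_comp, expect_bind]
  simp only [Function.comp, expect_pure]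

theorem expect_add (p : PMF α) (f g : α → ℝ≥0∞) :
    (expect p fun a => f a + g a) = expect p f + expect p g := by
  simp only [expect, mul_add, ENNReal.tsum_add]

theorem expect_const_mul (p : PMF α) (c : ℝ≥0∞) (f : α → ℝ≥0∞) :
    (expect p fun a => c * f a) = c * expect p f := by
  simp only [expect, ← ENNReal.tsum_mul_left, mul_left_comm]

theorem expect_mul_const (p : PMF α) (c : ℝ≥0∞) (f : α → ℝ≥0∞) :
    (expect p fun a => f a * c) = expect p f * c := by
  simp only [expect, ← ENNReal.tsum_mul_right, mul_assoc]

theorem expect_const (p : PMF α) (c : ℝ≥0∞) : (expect p fun _ => c) = c := by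
  rw [expect, ENNReal.tsum_mul_right, PMF.tsum_coe, one_mul]

theorem expect_mono (p : PMF α) {f g : α → ℝ≥0∞} (h : ∀ a, f a ≤ g a) :
    expect p f ≤ expect p g :=
  ENNReal.tsum_le_tsum fun a => mul_le_mul_right (h a) _

theorem expect_fintype [Fintype α] (p : PMF α) (f : α → ℝ≥0∞) :
    expect p f = ∑ a, p a * f a := tsum_fintype _

theorem bind_apply_eq_expect (p : PMF α) (k : α → PMF β) (b : β) :
    p.bind k b = expect p fun a => k a b := PMF.bind_apply _ _ _

/-- The joint law of independent draws from the laws `p 0, …, p (n - 1)`. -/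
noncomputable def prodLaw : (n : ℕ) → (Fin n → PMF α) → PMF (Fin n → α)
  | 0, _ => PMF.pure Fin.elim0
  | n + 1, p => (p 0).bind fun a => (prodLaw n fun i => p i.succ).map fun z => Fin.cons a z

theorem prodLaw_const (p : PMF α) : ∀ n, (prodLaw n fun _ => p) = iid p n
  | 0 => rfl
  | n + 1 => by simp only [prodLaw, iid, prodLaw_const p n]

theorem prodLaw_pure : ∀ (n : ℕ) (a : Fin n → α),
    (prodLaw n fun i => PMF.pure (a i)) = PMF.pure a
  | 0, a => by
    rw [prodLaw]
    congr 1
    exact Subsingleton.elim _ _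
  | n + 1, a => by
    rw [prodLaw, prodLaw_pure n, PMF.pure_bind, PMF.pure_map]
    congr 1
    exact Fin.cons_self_tail a

/-- Draws for different coordinates commute, so each index can be drawn just before its own move. -/
theorem iid_bind_prodLaw (p : PMF α) (k : α → PMF β) :
    ∀ n, ((iid p n).bind fun A => prodLaw n fun i => k (A i)) = iid (p.bind k) n
  | 0 => by simp only [iid, prodLaw, PMF.pure_bind]
  | n + 1 => by
    simp only [iid, prodLaw, PMF.bind_bind, PMF.bind_map, Function.comp_def, Fin.cons_zero,
      Fin.cons_succ, ← iid_bind_prodLaw p k n, PMF.map_bind]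
    congr 1
    funext a
    rw [PMF.bind_comm]

theorem expect_iid_sum (p : PMF α) (f : α → ℝ≥0∞) :
    ∀ n, (expect (iid p n) fun z => ∑ i, f (z i)) = n * expect p f
  | 0 => by simp [iid, expect_pure]
  | n + 1 => by
    simp only [iid, expect_bind, expect_map, Fin.sum_univ_succ, Fin.cons_zero, Fin.cons_succ,
      expect_add, expect_const, expect_iid_sum p f n]
    push_cast
    ring

/-- The off-diagonal pairs number `n (n - 1)`; the cruder `n ^ 2` is all that is needed and avoids
subtraction. -/
theorem expect_iid_sum_mul_sum_le (p : PMF α) (f g : α → ℝ≥0∞) :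
    ∀ n : ℕ, (expect (iid p n) fun z => (∑ i, f (z i)) * ∑ i, g (z i)) ≤
      n * (expect p fun a => f a * g a) + n ^ 2 * (expect p f * expect p g)
  | 0 => by simp [iid, expect_pure]
  | n + 1 => by
    simp only [iid, expect_bind, expect_map, Fin.sum_univ_succ, Fin.cons_zero, Fin.cons_succ,
      add_mul, mul_add, expect_add, expect_const, expect_const_mul, expect_mul_const,
      expect_iid_sum]
    refine (add_le_add_right (add_le_add_right (expect_iid_sum_mul_sum_le p f g n) _) _).trans ?_
    push_cast
    ring_nf
    exact le_self_add

end Expect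

/-! ### Laws and running times of composed programs -/

namespace Prog

variable {S : ℕ → Type u} {α : Type v} {β : Type w}

theorem law_bind (M : Model S) (s₀ : S 0) (p : Prog S α) (f : α → Prog S β) :
    (p.bind f).law M s₀ = (p.law M s₀).bind fun a => (f a).law M s₀ := by
  induction p <;> simp_all [Prog.bind, law]

theorem law_forEach (M : Model S) (s₀ : S 0) : ∀ (n : ℕ) (f : Fin n → Prog S α),
    (forEach n f).law M s₀ = prodLaw n fun i => (f i).law M s₀
  | 0, _ => rfl
  | n + 1, f => by
    simp only [forEach, law_bind, law, prodLaw, law_forEach M s₀ n, ← PMF.bind_pure_comp,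
      Function.comp_def]

theorem law_total (M : Model S) (s₀ : S 0) : ∀ (n : ℕ) (a : Fin n → ℝ),
    (total n a).law M s₀ = PMF.pure (∑ i, a i)
  | 0, _ => by simp [total, law]
  | n + 1, a => by
    simp only [total, law_bind, law, law_total M s₀ n, PMF.pure_bind, Fin.sum_univ_succ]

theorem time_bind_le (M : Model S) (s₀ : S 0) (p : Prog S α) (f : α → Prog S β) {a b : ℕ∞}
    (hp : p.time M s₀ ≤ a) (hf : ∀ x, (f x).time M s₀ ≤ b) :
    (p.bind f).time M s₀ ≤ a + b := by
  refine le_trans ?_ (add_le_add_left hp b)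
  -- With the exact cost of `p` in place of `a`, the induction on `p` needs no bound on its
  -- subprograms.
  clear hp
  induction p with
  | done a => simpa [Prog.bind, time] using hf a
  | tick k ih => simpa only [Prog.bind, time, add_assoc] using add_le_add_right ih _
  | add a c k ih => simpa only [Prog.bind, time, add_assoc] using add_le_add_right (ih _) _
  | div a c k ih => simpa only [Prog.bind, time, add_assoc] using add_le_add_right (ih _) _
  | reward x k ih => simpa only [Prog.bind, time, add_assoc] using add_le_add_right (ih _) _
  | sample x k ih =>
    simp only [Prog.bind, time, add_assoc]
    exact add_le_add_right (iSup_le fun s => (ih s).trans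
      (add_le_add_left (le_iSup (fun s => (k s).time M s₀) s) b)) _
  | draw w m k ih =>
    simp only [Prog.bind, time, add_assoc]
    exact add_le_add_right (iSup_le fun s => (ih s).trans
      (add_le_add_left (le_iSup (fun s => (k s).time M s₀) s) b)) _
  | uniform n k ih =>
    simp only [Prog.bind, time, add_assoc]
    exact add_le_add_right (iSup_le fun s => (ih s).trans
      (add_le_add_left (le_iSup (fun s => (k s).time M s₀) s) b)) _

theorem time_forEach_le (M : Model S) (s₀ : S 0) {b : ℕ} : ∀ (n : ℕ) (f : Fin n → Prog S α),
    (∀ i, (f i).time M s₀ ≤ b) → (forEach n f).time M s₀ ≤ ((n * (b + 1) : ℕ) : ℕ∞)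
  | 0, _, _ => by simp [forEach, time]
  | n + 1, f, h => by
    refine (time_bind_le M s₀ _ _ (h 0) (b := 1 + (((n * (b + 1) : ℕ) : ℕ∞) + 0))
      fun a => ?_).trans (le_of_eq ?_)
    · rw [time]
      exact add_le_add_right (time_bind_le M s₀ _ _
        (time_forEach_le M s₀ n _ fun i => h i.succ) fun _ => (by simp [time])) _
    · push_cast
      ring

theorem time_total_le (M : Model S) (s₀ : S 0) : ∀ (n : ℕ) (a : Fin n → ℝ),
    (total n a).time M s₀ ≤ n
  | 0, _ => by simp [total, time]
  | n + 1, a => by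
    push_cast
    refine time_bind_le M s₀ _ _ (time_total_le M s₀ n _) fun r => ?_
    simp [time]

end Prog

/-! ### Running time of the sampler -/

section Time

open Prog

variable {S : ℕ → Type u}

/-- Per particle: 4 to compute and store the weight, 1 for the sum, 2 to normalize and store, 2 for
the draw. -/
theorem time_ancestors_le (M : Model S) (s₀ : S 0) (N : ℕ+) {t : ℕ}
    (X : Fin N → Prefix S (t + 1)) :
    (ancestors N X).time M s₀ ≤ ((9 * N : ℕ) : ℕ∞) := by
  refine (time_bind_le M s₀ _ _ (time_forEach_le M s₀ (b := 3) _ _ fun i => ?_) fun w =>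
    time_bind_le M s₀ _ _ (time_total_le M s₀ _ _) fun Z =>
    time_bind_le M s₀ _ _ (time_forEach_le M s₀ (b := 1) _ _ fun i => ?_) fun wbar =>
    (?_ : _ ≤ (((N : ℕ) + N : ℕ) : ℕ∞))).trans ?_
  · simp only [time]; norm_num
  · simp only [time]; norm_num
  · simp [time]
  · exact le_of_eq (by push_cast; ring)

theorem time_propagate_le (M : Model S) (s₀ : S 0) (N : ℕ+) {t : ℕ}
    (X : Fin N → Prefix S t) :
    (propagate N X).time M s₀ ≤ ((2 * N : ℕ) : ℕ∞) := by
  refine (time_forEach_le M s₀ (b := 1) _ _ fun i => ?_).trans ?_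
  · simp [time]
  · exact le_of_eq (by push_cast; ring)

theorem time_particles_le (M : Model S) (s₀ : S 0) (N : ℕ+) : ∀ t : ℕ,
    (particles N t : Prog S _).time M s₀ ≤ ((11 * N * t + 2 * N : ℕ) : ℕ∞)
  | 0 => by simpa [particles] using time_propagate_le M s₀ N (t := 0) fun _ => PUnit.unit
  | t + 1 => by
    refine (time_bind_le M s₀ _ _ (time_particles_le M s₀ N t) fun X =>
      time_bind_le M s₀ _ _ (time_ancestors_le M s₀ N X) fun A =>
        time_propagate_le M s₀ N _).trans ?_
    norm_cast
    nlinarith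

theorem time_naiveSMC_le (M : Model S) (s₀ : S 0) (N : ℕ+) (T : ℕ) :
    (naiveSMC N (T + 1) : Prog S _).time M s₀ ≤ ((13 * N * (T + 1) : ℕ) : ℕ∞) := by
  refine (time_bind_le M s₀ _ _ (time_particles_le M s₀ N T) fun X =>
      time_bind_le M s₀ _ _ (time_ancestors_le M s₀ N X) fun A =>
      time_bind_le M s₀ _ _ (time_forEach_le M s₀ (b := 0) _ _ fun i => ?_) fun Y =>
        (?_ : _ ≤ ((1 : ℕ) : ℕ∞))).trans ?_
  · simp [time]
  · simp [time]
  -- The costs add up to `11 N T + 12 N + 1`, and `1 ≤ N`.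
  · have := N.pos
    norm_cast
    nlinarith [Nat.zero_le ((N : ℕ) * T)]

end Time

open Prog

/-! ### Resampling weights -/

section Resampling

theorem categorical_apply {N : ℕ+} (w : Fin N → ℝ) (hw : ∀ i, 0 < w i) (i : Fin N) :
    categorical w i = ENNReal.ofReal (w i) * (∑ j, ENNReal.ofReal (w j))⁻¹ := by
  have h : (∀ i, 0 ≤ w i) ∧ ∃ i, 0 < w i := ⟨fun i => (hw i).le, ⟨0, N.pos⟩, hw _⟩
  rw [categorical, dif_pos h, PMF.normalize_apply, tsum_fintype]

/-- `categorical` normalizes again, so the prior division by the sum cancels. -/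
theorem categorical_div_sum {N : ℕ+} (w : Fin N → ℝ) (hw : ∀ i, 0 < w i) (i : Fin N) :
    categorical (fun i => w i / ∑ j, w j) i =
      ENNReal.ofReal (w i) * (∑ j, ENNReal.ofReal (w j))⁻¹ := by
  have hZ : 0 < ∑ j, w j :=
    Finset.sum_pos (fun j _ => hw j) ⟨⟨0, N.pos⟩, Finset.mem_univ _⟩
  have hZ0 : ENNReal.ofReal (∑ j, w j) ≠ 0 := by simpa using hZ
  rw [categorical_apply _ fun i => div_pos (hw i) hZ]
  simp only [ENNReal.ofReal_div_of_pos hZ]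
  simp only [div_eq_mul_inv, ← Finset.sum_mul]
  rw [ENNReal.mul_inv (Or.inr (by simp [hZ0])) (Or.inr (by simp)), inv_inv, mul_assoc,
    mul_left_comm (_)⁻¹, ENNReal.inv_mul_cancel hZ0 ENNReal.ofReal_ne_top, mul_one]

end Resampling

/-! ### Law of the particle system -/

variable {S : ℕ → Type u} (M : Model S) (s₀ : S 0)

namespace Model

/-- The reward of a prefix as an extended nonnegative real. -/
noncomputable def reward {t : ℕ} (x : Prefix S t) : ℝ≥0∞ := ENNReal.ofReal (M.V s₀ x)

theorem reward_ne_zero {t : ℕ} (x : Prefix S t) : M.reward s₀ x ≠ 0 := by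
  simpa [reward] using M.V_pos s₀ x

theorem reward_ne_top {t : ℕ} (x : Prefix S t) : M.reward s₀ x ≠ ⊤ := ENNReal.ofReal_ne_top

/-- The function `F / V(s_{1:t})` of the prefix `s_{1:t+1}`. -/
noncomputable def ratio {t : ℕ} (F : Prefix S (t + 1) → ℝ≥0∞) (x : Prefix S (t + 1)) : ℝ≥0∞ :=
  F x * (M.reward s₀ x.init)⁻¹

/-- The conditional expectation of `F` after the prefix `x`. -/
noncomputable def condExpect {t : ℕ} (F : Prefix S (t + 1) → ℝ≥0∞) (x : Prefix S t) : ℝ≥0∞ :=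
  expect (M.ref s₀ x) fun s => F (x.snoc s)

theorem expect_refLaw_succ {t : ℕ} (F : Prefix S (t + 1) → ℝ≥0∞) :
    expect (M.refLaw s₀ (t + 1)) F = expect (M.refLaw s₀ t) (M.condExpect s₀ F) := by
  simp only [refLaw, expect_bind, expect_map]
  rfl

theorem expect_map_snoc_ratio {t : ℕ} (F : Prefix S (t + 1) → ℝ≥0∞) (x : Prefix S t) :
    expect ((M.ref s₀ x).map fun s => x.snoc s) (M.ratio s₀ F) =
      M.condExpect s₀ F x * (M.reward s₀ x)⁻¹ := by
  rw [expect_map]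
  exact expect_mul_const (M.ref s₀ x) (M.reward s₀ x)⁻¹ fun s => F (x.snoc s)

end Model

open Model

/-- The normalized incremental weights of a particle system. -/
noncomputable def normalizedWeights {N : ℕ+} {t : ℕ} (X : Fin N → Prefix S (t + 1)) (i : Fin N) :
    ℝ :=
  (M.V s₀ (X i) / M.V s₀ (X i).init) / ∑ j, M.V s₀ (X j) / M.V s₀ (X j).init

theorem law_ancestors {N : ℕ+} {t : ℕ} (X : Fin N → Prefix S (t + 1)) :
    (ancestors N X).law M s₀ = iid (categorical (normalizedWeights M s₀ X)) N := by
  simp only [ancestors, law_bind, law_forEach, law, prodLaw_pure, PMF.pure_bind, law_total,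
    PMF.bind_pure]
  rfl

theorem categorical_normalizedWeights {N : ℕ+} {t : ℕ} (X : Fin N → Prefix S (t + 1))
    (i : Fin N) :
    categorical (normalizedWeights M s₀ X) i =
      M.ratio s₀ (M.reward s₀) (X i) * (∑ j, M.ratio s₀ (M.reward s₀) (X j))⁻¹ := by
  have h : ∀ x : Prefix S (t + 1),
      ENNReal.ofReal (M.V s₀ x / M.V s₀ x.init) = M.ratio s₀ (M.reward s₀) x := fun x => by
    rw [ENNReal.ofReal_div_of_pos (M.V_pos _ _), div_eq_mul_inv]
    rfl
  simp only [← h]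
  exact categorical_div_sum (fun i => M.V s₀ (X i) / M.V s₀ (X i).init)
    (fun i => div_pos (M.V_pos _ _) (M.V_pos _ _)) i

theorem law_propagate {N : ℕ+} {t : ℕ} (X : Fin N → Prefix S t) :
    (propagate N X).law M s₀ =
      prodLaw N fun i => (M.ref s₀ (X i)).map fun s => (X i).snoc s := by
  simp only [propagate, law_forEach, law, ← PMF.bind_pure_comp, Function.comp_def]

/-- The law of a single particle after resampling and propagation of the particle system `X`. -/
noncomputable def transition {N : ℕ+} {t : ℕ} (X : Fin N → Prefix S (t + 1)) :
    PMF (Prefix S (t + 2)) :=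
  (categorical (normalizedWeights M s₀ X)).bind fun j =>
    (M.ref s₀ (X j)).map fun s => (X j).snoc s

theorem law_particles_succ (N : ℕ+) (t : ℕ) :
    (particles N (t + 1)).law M s₀ =
      ((particles N t).law M s₀).bind fun X => iid (transition M s₀ X) N := by
  simp only [particles, law_bind, law_ancestors, law_propagate]
  congr 1
  funext X
  exact iid_bind_prodLaw _ (fun j => (M.ref s₀ (X j)).map fun s => (X j).snoc s) _

theorem law_particles_zero (N : ℕ+) :
    (particles N 0).law M s₀ = iid (M.refLaw s₀ 1) N := by
  refine (law_propagate M s₀ (t := 0) _).trans ?_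
  rw [prodLaw_const]
  exact congrArg (iid · N) (PMF.pure_bind (α := Prefix S 0) PUnit.unit fun x =>
    (M.ref s₀ x).map fun s => x.snoc s).symm

/-- The numerator `V(X j)` of the incremental weight cancels the denominator of the child's ratio.
What remains is again a sum of ratios, one step earlier. -/
theorem expect_transition_ratio {N : ℕ+} {t : ℕ} (X : Fin N → Prefix S (t + 1))
    (F : Prefix S (t + 2) → ℝ≥0∞) :
    expect (transition M s₀ X) (M.ratio s₀ F) =
      (∑ j, M.ratio s₀ (M.condExpect s₀ F) (X j)) *
        (∑ j, M.ratio s₀ (M.reward s₀) (X j))⁻¹ := by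
  simp only [transition, expect_bind, expect_map_snoc_ratio]
  rw [expect_fintype, Finset.sum_mul]
  refine Finset.sum_congr rfl fun j _ => ?_
  rw [categorical_normalizedWeights, ratio, ratio]
  have := ENNReal.mul_inv_cancel (M.reward_ne_zero s₀ (X j)) (M.reward_ne_top s₀ (X j))
  calc _ = (M.reward s₀ (X j) * (M.reward s₀ (X j))⁻¹) * (M.condExpect s₀ F (X j) *
        (M.reward s₀ (X j).init)⁻¹ * (∑ j, M.ratio s₀ (M.reward s₀) (X j))⁻¹) := by ring
    _ = _ := by rw [this, one_mul]

theorem sum_ratio_reward_ne_zero {N : ℕ+} {t : ℕ} (X : Fin N → Prefix S (t + 1)) :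
    (∑ j, M.ratio s₀ (M.reward s₀) (X j)) ≠ 0 := by
  intro h
  have := (Finset.sum_eq_zero_iff.1 h) ⟨0, N.pos⟩ (Finset.mem_univ _)
  rcases mul_eq_zero.1 this with h | h
  · exact M.reward_ne_zero s₀ _ h
  · exact M.reward_ne_top s₀ _ (ENNReal.inv_eq_zero.1 h)

theorem sum_ratio_reward_ne_top {N : ℕ+} {t : ℕ} (X : Fin N → Prefix S (t + 1)) :
    (∑ j, M.ratio s₀ (M.reward s₀) (X j)) ≠ ⊤ :=
  ENNReal.sum_ne_top.2 fun _ _ => ENNReal.mul_ne_top (M.reward_ne_top s₀ _)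
    (ENNReal.inv_ne_top.2 (M.reward_ne_zero s₀ _))

/-- The final uniform choice averages `N` identically distributed ancestors, so `N` cancels;
`PMF.pure x y` is the indicator of `x = y`. -/
theorem law_naiveSMC_apply (N : ℕ+) (T : ℕ) (y : Prefix S (T + 1)) :
    (naiveSMC N (T + 1)).law M s₀ y = expect ((particles N T).law M s₀) fun X =>
      (∑ j, M.ratio s₀ (fun x => PMF.pure x y * M.reward s₀ x) (X j)) *
        (∑ j, M.ratio s₀ (M.reward s₀) (X j))⁻¹ := by
  simp only [naiveSMC, law_bind, bind_apply_eq_expect, law_ancestors, law_forEach, law,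
    prodLaw_pure, PMF.pure_bind]
  congr 1
  funext X
  have h : ∀ A : Fin N → Fin N,
      (expect (PMF.uniformOfFintype (Fin N)) fun i => PMF.pure (X (A i)) y) =
        ((N : ℕ) : ℝ≥0∞)⁻¹ * ∑ i, PMF.pure (X (A i)) y := fun A => by
    rw [expect_fintype, Finset.mul_sum]
    simp
  simp only [h]
  rw [expect_const_mul, expect_iid_sum _ fun j => PMF.pure (X j) y, ← mul_assoc,
    ENNReal.inv_mul_cancel (by simp) (by simp), one_mul, expect_fintype,
    Finset.sum_mul]
  refine Finset.sum_congr rfl fun j _ => ?_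
  rw [categorical_normalizedWeights, ratio, ratio]
  ring

/-! ### Consequences of the ratio and Bellman bounds -/

section Stability

variable {M s₀}

theorem Model.RatioBound.reward_le {T : ℕ} {L : ℝ} (h : M.RatioBound s₀ T L) {t : ℕ} (ht : t + 1 ≤ T)
    (x : Prefix S (t + 1)) : M.reward s₀ x ≤ ENNReal.ofReal L * M.reward s₀ x.init := by
  have h1 := (le_max_right _ _).trans (h t ht x)
  have h2 := (div_le_iff₀ (M.V_pos s₀ x.init)).1 h1
  rw [Model.reward, Model.reward, ← ENNReal.ofReal_mul' (M.V_pos _ _).le]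
  exact ENNReal.ofReal_le_ofReal h2

theorem Model.RatioBound.reward_init_le {T : ℕ} {L : ℝ} (h : M.RatioBound s₀ T L) {t : ℕ}
    (ht : t + 1 ≤ T) (x : Prefix S (t + 1)) :
    M.reward s₀ x.init ≤ ENNReal.ofReal L * M.reward s₀ x := by
  have h1 := (le_max_left _ _).trans (h t ht x)
  have h2 := (div_le_iff₀ (M.V_pos s₀ x)).1 h1
  rw [Model.reward, Model.reward, ← ENNReal.ofReal_mul' (M.V_pos _ _).le]
  exact ENNReal.ofReal_le_ofReal h2

/-- A positive number and its inverse are not both below 1, and some prefix of length one exists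
because a law has nonempty support. -/
theorem Model.RatioBound.one_le {T : ℕ} {L : ℝ} (hT : 1 ≤ T) (h : M.RatioBound s₀ T L) : 1 ≤ L := by
  obtain ⟨x, -⟩ := (M.refLaw s₀ 1).support_nonempty
  have h0 := h 0 hT x
  rcases le_total (M.V s₀ x) (M.V s₀ x.init) with h1 | h1
  · exact ((one_le_div (M.V_pos _ _)).2 h1).trans ((le_max_left _ _).trans h0)
  · exact ((one_le_div (M.V_pos _ _)).2 h1).trans ((le_max_right _ _).trans h0)

theorem Model.BellmanBound.condExpect {T : ℕ} {ε : ℝ} (h : M.BellmanBound s₀ T ε) {t : ℕ}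
    (h1 : 1 ≤ t) (ht : t < T) (x : Prefix S t) :
    M.condExpect s₀ (M.reward s₀) x ≤ ENNReal.ofReal (1 + ε) * M.reward s₀ x ∧
      M.reward s₀ x ≤ ENNReal.ofReal (1 + ε) * M.condExpect s₀ (M.reward s₀) x := by
  obtain ⟨hs, hm⟩ := h t h1 ht x
  have hnn : ∀ s, 0 ≤ (M.ref s₀ x s).toReal * M.V s₀ (x.snoc s) := fun s =>
    mul_nonneg ENNReal.toReal_nonneg (M.V_pos _ _).le
  -- Summability is essential: a divergent real `tsum` would take the default value 0.
  have hC : M.condExpect s₀ (M.reward s₀) x = ENNReal.ofReal (M.lookahead s₀ x) := by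
    rw [lookahead, ENNReal.ofReal_tsum_of_nonneg hnn hs]
    refine tsum_congr fun s => ?_
    rw [ENNReal.ofReal_mul ENNReal.toReal_nonneg, ENNReal.ofReal_toReal (PMF.apply_ne_top _ _)]
    rfl
  have hpos : 0 < M.lookahead s₀ x := by
    obtain ⟨s, hs'⟩ := (M.ref s₀ x).support_nonempty
    exact hs.tsum_pos hnn s (mul_pos (ENNReal.toReal_pos ((PMF.mem_support_iff _ _).1 hs')
      (PMF.apply_ne_top _ _)) (M.V_pos _ _))
  rw [hC, Model.reward, ← ENNReal.ofReal_mul' (M.V_pos _ _).le, ← ENNReal.ofReal_mul' hpos.le]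
  exact ⟨ENNReal.ofReal_le_ofReal ((div_le_iff₀ (M.V_pos _ _)).1 ((le_max_right _ _).trans hm)),
    ENNReal.ofReal_le_ofReal ((div_le_iff₀ hpos).1 ((le_max_left _ _).trans hm))⟩

theorem condExpect_mono {t : ℕ} {F G : Prefix S (t + 1) → ℝ≥0∞} (h : ∀ x, F x ≤ G x)
    (x : Prefix S t) : M.condExpect s₀ F x ≤ M.condExpect s₀ G x :=
  expect_mono _ fun _ => h _

theorem condExpect_const_mul {t : ℕ} (c : ℝ≥0∞) (F : Prefix S (t + 1) → ℝ≥0∞) (x : Prefix S t) :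
    M.condExpect s₀ (fun y => c * F y) x = c * M.condExpect s₀ F x :=
  expect_const_mul _ _ _

end Stability

/-! ### Averaging quadratic lower bounds -/

section Averaging

variable {α : Type v}

/-- This is `b⁻¹ (1 - l b)² ≥ 0`. It turns a quotient into a family of quadratics, the starting
point of the backward induction. -/
theorem two_mul_le_inv_add {b : ℝ≥0∞} (hb0 : b ≠ 0) (hb : b ≠ ⊤) (l : ℝ≥0∞) :
    2 * l ≤ b⁻¹ + l ^ 2 * b := by
  rcases eq_or_ne l ⊤ with rfl | hl
  · simp [ENNReal.top_mul hb0]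
  lift b to NNReal using hb
  lift l to NNReal using hl
  have hb' : b ≠ 0 := by exact_mod_cast hb0
  rw [← ENNReal.coe_inv hb']
  norm_cast
  rw [← NNReal.coe_le_coe]
  push_cast
  have hpos : (0 : ℝ) < b := by positivity
  have : (b : ℝ)⁻¹ + l ^ 2 * b - 2 * l = (b : ℝ)⁻¹ * (1 - l * b) ^ 2 := by
    field_simp
    ring
  nlinarith [mul_nonneg (inv_nonneg.2 hpos.le) (sq_nonneg (1 - (l : ℝ) * b))]

/-- If a functional of a particle system dominates a concave quadratic in the particle sums, so
does its mean over independent particles, up to a relative loss of order `1 / N`. -/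
theorem expect_iid_lower_bound (p : PMF α) (N : ℕ+) (f h : α → ℝ≥0∞)
    (O : (Fin N → α) → ℝ≥0∞) (κ ρ : ℝ≥0∞)
    (hO : ∀ z l, 2 * l * ∑ i, f (z i) ≤ O z + l ^ 2 * κ * ((∑ i, f (z i)) * ∑ i, h (z i)))
    (hρ : (expect p fun a => f a * h a) ≤ ρ * (expect p f * expect p h)) (l : ℝ≥0∞) :
    2 * l * expect p f ≤ expect (iid p N) O +
      l ^ 2 * (κ * (1 + ρ / (N : ℕ))) * (expect p f * expect p h) := by
  have hN : ((N : ℕ) : ℝ≥0∞) * ((N : ℕ) : ℝ≥0∞)⁻¹ = 1 :=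
    ENNReal.mul_inv_cancel (by simp) (by simp)
  set n : ℝ≥0∞ := ((N : ℕ) : ℝ≥0∞)
  -- Scaling `l` by `1 / N` turns the particle sums into empirical means.
  have key := expect_mono (iid p N) fun z => hO z (l * n⁻¹)
  rw [expect_const_mul, expect_add, expect_const_mul, expect_iid_sum] at key
  calc 2 * l * expect p f = 2 * (l * n⁻¹) * (n * expect p f) := by
        rw [show 2 * (l * n⁻¹) * (n * expect p f) = 2 * l * expect p f * (n * n⁻¹) by ring, hN,
          mul_one]
    _ ≤ _ := key
    _ ≤ expect (iid p N) O + (l * n⁻¹) ^ 2 * κ *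
          (n * (ρ * (expect p f * expect p h)) + n ^ 2 * (expect p f * expect p h)) := by
        gcongr
        exact (expect_iid_sum_mul_sum_le p f h N).trans (by gcongr)
    _ = expect (iid p N) O + l ^ 2 * κ * (expect p f * expect p h) *
          ((n * n⁻¹) ^ 2 + ρ * n⁻¹ * (n * n⁻¹)) := by ring
    _ = _ := by
        rw [hN, div_eq_mul_inv]
        ring

end Averaging

/-! ### Backward induction and domination of the target -/

section Induction

variable {S : ℕ → Type u} {M : Model S} {s₀ : S 0}

/-- The ratio of `H` is at most `B L` everywhere, and its mean is at least `1 / C`; inserting the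
latter restores the product of means. -/
theorem expect_ratio_mul_ratio_le {T : ℕ} {L : ℝ} (hR : M.RatioBound s₀ T L) {t : ℕ}
    (ht : t + 1 ≤ T) (p : PMF (Prefix S (t + 1))) (F H : Prefix S (t + 1) → ℝ≥0∞) {B C : ℝ≥0∞}
    (hH : ∀ x, H x ≤ B * M.reward s₀ x) (hC : 1 ≤ C * expect p (M.ratio s₀ H)) :
    (expect p fun x => M.ratio s₀ F x * M.ratio s₀ H x) ≤
      B * ENNReal.ofReal L * C * (expect p (M.ratio s₀ F) * expect p (M.ratio s₀ H)) := by
  have h : ∀ x, M.ratio s₀ H x ≤ B * ENNReal.ofReal L := fun x => by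
    rw [ratio]
    calc _ ≤ B * (ENNReal.ofReal L * M.reward s₀ x.init) * (M.reward s₀ x.init)⁻¹ := by
          gcongr
          exact (hH x).trans (by gcongr; exact hR.reward_le ht x)
      _ = B * ENNReal.ofReal L * (M.reward s₀ x.init * (M.reward s₀ x.init)⁻¹) := by ring
      _ = _ := by
          rw [ENNReal.mul_inv_cancel (M.reward_ne_zero s₀ _) (M.reward_ne_top s₀ _), mul_one]
  calc _ ≤ expect p fun x => M.ratio s₀ F x * (B * ENNReal.ofReal L) :=
        expect_mono _ fun x => by gcongr; exact h x
    _ = expect p (M.ratio s₀ F) * (B * ENNReal.ofReal L) * 1 := by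
        rw [expect_mul_const p _ (M.ratio s₀ F), mul_one]
    _ ≤ expect p (M.ratio s₀ F) * (B * ENNReal.ofReal L) * (C * expect p (M.ratio s₀ H)) := by
        gcongr
    _ = _ := by ring

theorem expect_refLaw_one_ratio (F : Prefix S 1 → ℝ≥0∞) :
    expect (M.refLaw s₀ 1) (M.ratio s₀ F) =
      expect (M.refLaw s₀ 1) F * (M.reward s₀ (t := 0) PUnit.unit)⁻¹ :=
  expect_mul_const (M.refLaw s₀ 1) (M.reward s₀ (t := 0) PUnit.unit)⁻¹ F

/-- The particle system keeps a quadratic lower bound from the last to the first step. -/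
theorem particles_lower_bound {T : ℕ} {L ε : ℝ} (hR : M.RatioBound s₀ T L)
    (hB : M.BellmanBound s₀ T ε) (hε : 0 < ε) (N : ℕ+) (K : ℝ≥0∞) :
    ∀ t : ℕ, t + 1 ≤ T → ∀ (B κ : ℝ≥0∞) (F H : Prefix S (t + 1) → ℝ≥0∞)
      (O : (Fin N → Prefix S (t + 1)) → ℝ≥0∞),
      (∀ x, H x ≤ B * M.reward s₀ x) → (∀ x, M.reward s₀ x ≤ B * H x) →
      B * ENNReal.ofReal (1 + ε) ^ t ≤ K →
      (∀ X l, 2 * l * ∑ i, M.ratio s₀ F (X i) ≤ O X +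
        l ^ 2 * κ * ((∑ i, M.ratio s₀ F (X i)) * ∑ i, M.ratio s₀ H (X i))) →
      ∀ l, 2 * l * expect (M.refLaw s₀ (t + 1)) F ≤ expect ((particles N t).law M s₀) O +
        l ^ 2 * (κ * (1 + (K * ENNReal.ofReal L) ^ 2 / (N : ℕ)) ^ (t + 1)) *
          (expect (M.refLaw s₀ (t + 1)) F * expect (M.refLaw s₀ (t + 1)) H)
  | 0, ht, B, κ, F, H, O, hH, hH', hK, hO, l => by
    have hv0 := M.reward_ne_zero s₀ (t := 0) PUnit.unit
    have hv := M.reward_ne_top s₀ (t := 0) PUnit.unit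
    have hF := expect_refLaw_one_ratio (M := M) (s₀ := s₀) F
    have hHr := expect_refLaw_one_ratio (M := M) (s₀ := s₀) H
    have hcancel := ENNReal.mul_inv_cancel hv0 hv
    set v := M.reward s₀ (t := 0) PUnit.unit
    rw [pow_zero, mul_one] at hK
    -- The Bellman bound does not cover the empty prefix, so the ratio bound is used instead; this
    -- costs a second factor `L`.
    have h1 : 1 ≤ B * ENNReal.ofReal L * expect (M.refLaw s₀ 1) (M.ratio s₀ H) := by
      calc 1 = expect (M.refLaw s₀ 1) (fun _ => v) * v⁻¹ := by rw [expect_const, hcancel]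
        _ ≤ expect (M.refLaw s₀ 1) (fun x => B * ENNReal.ofReal L * H x) * v⁻¹ := by
            gcongr
            refine expect_mono _ fun x => (hR.reward_init_le ht x).trans ?_
            calc _ ≤ ENNReal.ofReal L * (B * H x) := by gcongr; exact hH' x
              _ = _ := by ring
        _ = _ := by rw [expect_const_mul _ _ H, hHr]; ring
    have h2 := (expect_ratio_mul_ratio_le hR ht _ F H hH h1).trans
      (mul_le_mul_left (show _ ≤ (K * ENNReal.ofReal L) ^ 2 by
        rw [sq]
        gcongr) _)
    -- The factor `v` in `l` cancels the reward of the empty prefix, which need not be 1.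
    have h3 := expect_iid_lower_bound _ N _ _ O κ _ hO h2 (l * v)
    rw [hF, hHr] at h3
    rw [law_particles_zero, show (1 + (K * ENNReal.ofReal L) ^ 2 / ((N : ℕ) : ℝ≥0∞)) ^ (0 + 1) =
      1 + (K * ENNReal.ofReal L) ^ 2 / (N : ℕ) from pow_one _]
    calc _ = 2 * l * expect (M.refLaw s₀ 1) F * (v * v⁻¹) := by rw [hcancel, mul_one]
      _ = 2 * (l * v) * (expect (M.refLaw s₀ 1) F * v⁻¹) := by ring
      _ ≤ _ := h3
      _ = expect (iid (M.refLaw s₀ 1) N) O +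
        l ^ 2 * (κ * (1 + (K * ENNReal.ofReal L) ^ 2 / (N : ℕ))) *
          (expect (M.refLaw s₀ 1) F * expect (M.refLaw s₀ 1) H) * (v * v⁻¹) ^ 2 := by ring
      _ = _ := by rw [hcancel, one_pow, mul_one]
  | t + 1, ht, B, κ, F, H, O, hH, hH', hK, hO, l => by
    set D := ENNReal.ofReal (1 + ε)
    have hD : 1 ≤ D := by
      rw [← ENNReal.ofReal_one]
      exact ENNReal.ofReal_le_ofReal (by linarith)
    have hL : 1 ≤ ENNReal.ofReal L := by
      rw [← ENNReal.ofReal_one]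
      exact ENNReal.ofReal_le_ofReal (hR.one_le (by omega))
    have hBD : B * D ≤ K := le_trans (mul_le_mul_right (le_self_pow₀ hD (by omega)) _) hK
    have hBK : B ≤ K := le_trans (le_mul_of_one_le_right' hD) hBD
    have hbell := hB.condExpect (t := t + 1) (by omega) (by omega)
    have hM : ∀ x, M.condExpect s₀ H x ≤ B * D * M.reward s₀ x := fun x => by
      calc _ ≤ B * M.condExpect s₀ (M.reward s₀) x :=
            (condExpect_mono hH x).trans_eq (condExpect_const_mul _ _ _)
        _ ≤ B * (D * M.reward s₀ x) := by gcongr; exact (hbell x).1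
        _ = _ := by ring
    have hM' : ∀ x, M.reward s₀ x ≤ B * D * M.condExpect s₀ H x := fun x => by
      calc _ ≤ D * M.condExpect s₀ (M.reward s₀) x := (hbell x).2
        _ ≤ D * (B * M.condExpect s₀ H x) := by
            gcongr
            exact (condExpect_mono hH' x).trans_eq (condExpect_const_mul _ _ _)
        _ = _ := by ring
    -- One step back costs `B` a factor `D` and `κ` a factor `1 + ρ / N`; the functional becomes the
    -- conditional mean of `O` given the particles one step earlier.
    have step := particles_lower_bound hR hB hε N K t (by omega) (B * D)
      (κ * (1 + (K * ENNReal.ofReal L) ^ 2 / (N : ℕ))) (M.condExpect s₀ F) (M.condExpect s₀ H)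
      (fun X => expect (iid (transition M s₀ X) N) O) hM hM'
      (by rw [mul_assoc, ← pow_succ']; exact hK) ?_ l
    · rw [law_particles_succ, expect_bind, expect_refLaw_succ M s₀ F, expect_refLaw_succ M s₀ H,
        pow_succ' _ (t + 1), ← mul_assoc κ]
      exact step
    · intro X l
      have hF := expect_transition_ratio M s₀ X F
      have hHr := expect_transition_ratio M s₀ X H
      have hcancel := ENNReal.mul_inv_cancel (sum_ratio_reward_ne_zero M s₀ X)
        (sum_ratio_reward_ne_top M s₀ X)
      have h0 : (∑ j, M.ratio s₀ (M.reward s₀) (X j)) ≤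
          B * D * ∑ j, M.ratio s₀ (M.condExpect s₀ H) (X j) := by
        rw [Finset.mul_sum]
        refine Finset.sum_le_sum fun j _ => ?_
        rw [ratio, ratio, ← mul_assoc]
        gcongr
        exact hM' _
      set W := ∑ j, M.ratio s₀ (M.reward s₀) (X j)
      have h1 : 1 ≤ B * D * expect (transition M s₀ X) (M.ratio s₀ H) := by
        rw [hHr, ← hcancel, ← mul_assoc]
        gcongr
      have h2 := (expect_ratio_mul_ratio_le hR ht _ F H hH h1).trans
        (mul_le_mul_left (show _ ≤ (K * ENNReal.ofReal L) ^ 2 by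
          calc _ ≤ K * ENNReal.ofReal L * K * 1 := by rw [mul_one]; gcongr
            _ ≤ K * ENNReal.ofReal L * K * ENNReal.ofReal L := by gcongr
            _ = _ := by ring) _)
      -- The bound holds for every `l`, so the random normalizer `W` may be absorbed in it.
      have h3 := expect_iid_lower_bound _ N _ _ O κ _ hO h2 (l * W)
      rw [hF, hHr] at h3
      set a := ∑ j, M.ratio s₀ (M.condExpect s₀ F) (X j)
      set b := ∑ j, M.ratio s₀ (M.condExpect s₀ H) (X j)
      calc _ = 2 * l * a * (W * W⁻¹) := by rw [hcancel, mul_one]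
        _ = 2 * (l * W) * (a * W⁻¹) := by ring
        _ ≤ _ := h3
        _ = expect (iid (transition M s₀ X) N) O +
          l ^ 2 * (κ * (1 + (K * ENNReal.ofReal L) ^ 2 / (N : ℕ))) * (a * b) *
            (W * W⁻¹) ^ 2 := by ring
        _ = _ := by rw [hcancel, one_pow, mul_one]

theorem target_apply {T : ℕ} {L : ℝ} (hR : M.RatioBound s₀ T L) (y : Prefix S T) :
    M.target s₀ T hR y = M.refLaw s₀ T y * M.reward s₀ y *
      (expect (M.refLaw s₀ T) (M.reward s₀))⁻¹ :=
  PMF.normalize_apply _ _ _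

theorem target_le {T : ℕ} {L ε : ℝ} (hR : M.RatioBound s₀ (T + 1) L)
    (hB : M.BellmanBound s₀ (T + 1) ε) (hε : 0 < ε) (N : ℕ+) (K : ℝ≥0∞) (hKtop : K ≠ ⊤)
    (hK : ENNReal.ofReal (1 + ε) ^ T ≤ K) (y : Prefix S (T + 1)) :
    M.target s₀ (T + 1) hR y ≤
      (1 + (K * ENNReal.ofReal L) ^ 2 / (N : ℕ)) ^ (T + 1) *
        (naiveSMC N (T + 1)).law M s₀ y := by
  set κ := (1 + (K * ENNReal.ofReal L) ^ 2 / (N : ℕ)) ^ (T + 1)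
  have hκ0 : κ ≠ 0 := pow_ne_zero _ (by simp)
  have hκ : κ ≠ ⊤ := ENNReal.pow_ne_top (ENNReal.add_ne_top.2 ⟨by simp, ENNReal.div_ne_top
    (ENNReal.pow_ne_top (ENNReal.mul_ne_top hKtop ENNReal.ofReal_ne_top)) (by simp)⟩)
  have hZ0 : expect (M.refLaw s₀ (T + 1)) (M.reward s₀) ≠ 0 := M.normalizer_ne_zero s₀ _
  have hZ : expect (M.refLaw s₀ (T + 1)) (M.reward s₀) ≠ ⊤ := hR.normalizer_ne_top
  have hF : (expect (M.refLaw s₀ (T + 1)) fun x => PMF.pure x y * M.reward s₀ x) =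
      M.refLaw s₀ (T + 1) y * M.reward s₀ y := by
    rw [expect, tsum_eq_single y]
    · simp
    · intro x hx
      simp [PMF.pure_apply, hx.symm]
  -- The last argument is the `l` that maximizes `2 l A - l² κ A Z`, with `A`, `Z` the means of the
  -- two functions; the value there is `A / (κ Z)`.
  have h := particles_lower_bound hR hB hε N K T le_rfl 1 1
    (fun x => PMF.pure x y * M.reward s₀ x) (M.reward s₀)
    (fun X => (∑ j, M.ratio s₀ (fun x => PMF.pure x y * M.reward s₀ x) (X j)) *
        (∑ j, M.ratio s₀ (M.reward s₀) (X j))⁻¹) (fun x => (one_mul _).ge)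
    (fun x => (one_mul _).ge) (by rwa [one_mul]) (fun X l => ?_)
    (κ⁻¹ * (expect (M.refLaw s₀ (T + 1)) (M.reward s₀))⁻¹)
  · rw [← law_naiveSMC_apply, hF, one_mul] at h
    rw [target_apply]
    set Z := expect (M.refLaw s₀ (T + 1)) (M.reward s₀)
    set A := M.refLaw s₀ (T + 1) y * M.reward s₀ y
    have hA : A ≠ ⊤ := ENNReal.mul_ne_top (PMF.apply_ne_top _ _) (M.reward_ne_top s₀ y)
    have c1 := ENNReal.mul_inv_cancel hκ0 hκ
    have c2 := ENNReal.mul_inv_cancel hZ0 hZ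
    -- The finite term stands on both sides so that it can be cancelled in `ℝ≥0∞`.
    have h' : κ⁻¹ * Z⁻¹ * A + κ⁻¹ * Z⁻¹ * A ≤
        (naiveSMC N (T + 1)).law M s₀ y + κ⁻¹ * Z⁻¹ * A := by
      calc _ = 2 * (κ⁻¹ * Z⁻¹) * A := by ring
        _ ≤ _ := h
        _ = (naiveSMC N (T + 1)).law M s₀ y +
            κ⁻¹ * Z⁻¹ * A * ((κ * κ⁻¹) * (Z * Z⁻¹)) := by ring
        _ = _ := by rw [c1, c2, one_mul, mul_one]
    have h2 := (ENNReal.add_le_add_iff_right (ENNReal.mul_ne_top (ENNReal.mul_ne_top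
      (ENNReal.inv_ne_top.2 hκ0) (ENNReal.inv_ne_top.2 hZ0)) hA)).1 h'
    calc A * Z⁻¹ = κ * (κ⁻¹ * Z⁻¹ * A) := by
          rw [show κ * (κ⁻¹ * Z⁻¹ * A) = (κ * κ⁻¹) * (A * Z⁻¹) by ring, c1, one_mul]
      _ ≤ _ := by gcongr
  · have := mul_le_mul_left (two_mul_le_inv_add (sum_ratio_reward_ne_zero M s₀ X)
      (sum_ratio_reward_ne_top M s₀ X) l)
      (∑ j, M.ratio s₀ (fun x => PMF.pure x y * M.reward s₀ x) (X j))
    refine this.trans (le_of_eq ?_)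
    ring

end Induction

/-! ### From pointwise domination to total variation -/

section TotalVariation

variable {α : Type v}

/-- `|p - q| = (q - p) + 2 (p - q)⁺` and `(p - q)⁺ ≤ (1 - r) p`; the sum over all points is at most
`2 (1 - r)`. -/
theorem tvDist_le_of_mul_le (p q : PMF α) (r : ℝ)
    (h : ∀ a, r * (p a).toReal ≤ (q a).toReal) (hr : r ≤ 1) : tvDist p q ≤ 1 - r := by
  have hsum : ∀ p : PMF α, HasSum (fun a => (p a).toReal) 1 := fun p => by
    have := (ENNReal.summable_toReal p.tsum_coe_ne_top).hasSum
    rwa [← ENNReal.tsum_toReal_eq p.apply_ne_top, p.tsum_coe, ENNReal.toReal_one] at this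
  have h1 : HasSum (fun a => (2 * (1 - r) - 1) * (p a).toReal + (q a).toReal)
      ((2 * (1 - r) - 1) * 1 + 1) := ((hsum p).mul_left _).add (hsum q)
  have h2 : ∀ a, |(p a).toReal - (q a).toReal| ≤
      (2 * (1 - r) - 1) * (p a).toReal + (q a).toReal := fun a => by
    have hp : 0 ≤ (p a).toReal := ENNReal.toReal_nonneg
    rw [abs_le]
    constructor <;> nlinarith [h a, mul_nonneg (sub_nonneg.2 hr) hp]
  have h3 : Summable fun a => |(p a).toReal - (q a).toReal| :=
    Summable.of_nonneg_of_le (fun _ => abs_nonneg _) h2 h1.summable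
  have h4 := h3.tsum_le_tsum h2 h1.summable
  rw [h1.tsum_eq] at h4
  rw [tvDist]
  linarith

/-- For `x ≤ 1` take `r = (1 - x)^T`: it is at most `(1 + x)^(-T)`, and at least `1 - T x` by
Bernoulli. For `x > 1` and `T ≥ 1` the trivial bound 1 is enough. -/
theorem tvDist_le_of_le_pow_mul (p q : PMF α) (T : ℕ) (x : ℝ) (hx : 0 ≤ x)
    (h : ∀ a, p a ≤ (1 + ENNReal.ofReal x) ^ T * q a) : tvDist p q ≤ T * x := by
  rcases lt_or_ge 1 x with hx1 | hx1
  · rcases Nat.eq_zero_or_pos T with rfl | hT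
    · have := tvDist_le_of_mul_le p q 1 (fun a => by
        rw [one_mul]
        exact ENNReal.toReal_mono (q.apply_ne_top a) (by simpa using h a)) le_rfl
      simpa using this
    · have := tvDist_le_of_mul_le p q 0 (fun a => by
        rw [zero_mul]; exact ENNReal.toReal_nonneg) zero_le_one
      have hT' : (1 : ℝ) ≤ T := by exact_mod_cast hT
      nlinarith
  · have hb := one_add_mul_le_pow (a := -x) (by linarith) T
    have hpow : (1 - x) ^ T * (1 + x) ^ T ≤ 1 := by
      rw [← mul_pow]
      exact pow_le_one₀ (mul_nonneg (by linarith) (by linarith)) (by nlinarith)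
    refine (tvDist_le_of_mul_le p q ((1 - x) ^ T) (fun a => ?_)
      (pow_le_one₀ (by linarith) (by linarith))).trans ?_
    · have h1 : (p a).toReal ≤ (1 + x) ^ T * (q a).toReal := by
        have := ENNReal.toReal_mono (ENNReal.mul_ne_top (ENNReal.pow_ne_top (by simp))
          (q.apply_ne_top a)) (h a)
        rwa [ENNReal.toReal_mul, ENNReal.toReal_pow, ENNReal.toReal_add (by simp) (by simp),
          ENNReal.toReal_one, ENNReal.toReal_ofReal hx] at this
      have h0 : 0 ≤ (1 - x) ^ T := pow_nonneg (by linarith) _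
      have hq : 0 ≤ (q a).toReal := ENNReal.toReal_nonneg
      nlinarith [mul_le_mul_of_nonneg_left h1 h0, mul_le_mul_of_nonneg_right hpow hq]
    · rw [← sub_eq_add_neg] at hb
      linarith

end TotalVariation

end InferenceSMC

/-! ### Choice of the number of particles -/

theorem corollary5 (c : ℝ) (hc : 0 < c) :
    ∃ C : ℝ, 0 < C ∧
      ∀ (T : ℕ) (L δ : ℝ), 1 ≤ T → 0 < L → 0 < δ → δ < 1 →
        ∃ N : ℕ+,
          ∀ (S : ℕ → Type u) (M : InferenceSMC.Model S) (s₀ : S 0) (ε : ℝ),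
            0 < ε → ε ≤ c / T →
            ∀ hL : M.RatioBound s₀ T L, M.BellmanBound s₀ T ε →
              InferenceSMC.tvDist (M.target s₀ T hL)
                  ((InferenceSMC.naiveSMC N T).law M s₀) ≤ δ ∧
              ((InferenceSMC.naiveSMC N T).time M s₀ : ℝ≥0∞) ≤
                ENNReal.ofReal (C * (L ^ 6 * (T : ℝ) ^ 2 / δ)) := by
  -- `26 = 13 · 2`: time at most `13 N T`, and rounding up at most doubles `R ≥ 1`.
  refine ⟨26 * Real.exp c ^ 2, by positivity, fun T L δ hT hL0 hδ hδ1 => ?_⟩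
  rcases lt_or_ge L 1 with hL1 | hL1
  -- No model satisfies the ratio bound with `L < 1`, so any `N` will do.
  · exact ⟨1, fun S M s₀ ε _ _ hL _ => absurd (hL.one_le hT) (not_le.2 hL1)⟩
  obtain ⟨T, rfl⟩ : ∃ T', T = T' + 1 := ⟨T - 1, by omega⟩
  have hT' : (1 : ℝ) ≤ ((T + 1 : ℕ) : ℝ) := by exact_mod_cast hT
  set τ : ℝ := ((T + 1 : ℕ) : ℝ)
  -- `R` is the value of `N` at which `T (exp c · L)² / N` equals `δ`.
  set R : ℝ := τ * (Real.exp c * L) ^ 2 / δ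
  have hexp : 1 ≤ Real.exp c := Real.one_le_exp hc.le
  have hR1 : 1 ≤ R := by
    have h1 : 1 ≤ (Real.exp c * L) ^ 2 := one_le_pow₀ (by nlinarith)
    rw [one_le_div hδ]
    nlinarith
  have hN : 0 < ⌈R⌉₊ := Nat.ceil_pos.2 (by linarith)
  refine ⟨⟨⌈R⌉₊, hN⟩, fun S M s₀ ε hε hεc hL hB => ⟨?_, ?_⟩⟩
  · have hNR : (0 : ℝ) < ⌈R⌉₊ := by exact_mod_cast hN
    have hK : ENNReal.ofReal (1 + ε) ^ T ≤ ENNReal.ofReal (Real.exp c) := by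
      rw [← ENNReal.ofReal_pow (by linarith)]
      refine ENNReal.ofReal_le_ofReal ?_
      calc (1 + ε) ^ T ≤ Real.exp ε ^ T := by
            gcongr
            linarith [Real.add_one_le_exp ε]
        _ = Real.exp (T * ε) := (Real.exp_nat_mul ε T).symm
        _ ≤ Real.exp c := by
            rw [le_div_iff₀ (by linarith)] at hεc
            refine Real.exp_le_exp.2 (le_trans ?_ hεc)
            simp only [τ]
            push_cast
            linarith
    refine (InferenceSMC.tvDist_le_of_le_pow_mul _ _ (T + 1)
      ((Real.exp c * L) ^ 2 / ⌈R⌉₊) (by positivity) fun y => ?_).trans ?_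
    · have := InferenceSMC.target_le hL hB hε ⟨⌈R⌉₊, hN⟩ _ ENNReal.ofReal_ne_top hK y
      rwa [← ENNReal.ofReal_mul (by positivity), ← ENNReal.ofReal_pow (by positivity),
        PNat.mk_coe, ← ENNReal.ofReal_natCast, ← ENNReal.ofReal_div_of_pos hNR] at this
    · have h1 : τ * (Real.exp c * L) ^ 2 ≤ ⌈R⌉₊ * δ := (div_le_iff₀ hδ).1 (Nat.le_ceil R)
      rw [← mul_div_assoc, div_le_iff₀ hNR]
      linarith
  · have h1 : (((InferenceSMC.naiveSMC ⟨⌈R⌉₊, hN⟩ (T + 1) : InferenceSMC.Prog S _).time M s₀ :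
        ℕ∞) : ℝ≥0∞) ≤ ((13 * ⌈R⌉₊ * (T + 1) : ℕ) : ℝ≥0∞) := by
      rw [← ENat.toENNReal_coe]
      exact ENat.toENNReal_le.2 (InferenceSMC.time_naiveSMC_le M s₀ ⟨⌈R⌉₊, hN⟩ T)
    refine h1.trans ?_
    rw [← ENNReal.ofReal_natCast]
    refine ENNReal.ofReal_le_ofReal ?_
    have h2 : (⌈R⌉₊ : ℝ) ≤ 2 * R := by linarith [Nat.ceil_lt_add_one (show 0 ≤ R by linarith)]
    -- The argument yields `L ^ 2`; the claimed power is weaker because `1 ≤ L`.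
    have h3 : L ^ 2 ≤ L ^ 6 := pow_le_pow_right₀ hL1 (by norm_num)
    calc ((13 * ⌈R⌉₊ * (T + 1) : ℕ) : ℝ) = 13 * ⌈R⌉₊ * τ := by push_cast; simp [τ]
      _ ≤ 13 * (2 * R) * τ := by gcongr
      _ = 26 * Real.exp c ^ 2 * (L ^ 2 * τ ^ 2 / δ) := by simp only [R]; ring
      _ ≤ _ := by gcongr
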